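/- Let $V$ be a $3$-dimensional complex vector space with a Hermitian form $\langle\cdot,\cdot\rangle$ (linear in the first variable) of signature $++-$, let $\mathrm{SU}(2,1)$ be the group of linear automorphisms of $V$ of determinant $1$ preserving the form, and let $\mathrm{PU}(2,1)=\mathrm{SU}(2,1)/\{1,\omega,\omega^2\}$, where $\omega=e^{2\pi i/3}$; elements of $\mathrm{PU}(2,1)$ are called isometries. Put $\Omega=\{1,\omega,\omega^2\}$ and $-\Omega=\{-1,-\omega,-\omega^2\}$. For a complex number $\alpha$ with $|\alpha|=1$ and $\alpha\notin\Omega$, and a nonisotropic point $p\in\mathbb PV$ (that is, $\langle p,p\rangle\ne0$), the special elliptic isometry with center $p$ and parameter $\alpha$ is $$R_\alpha^p:\ x\mapsto(\alpha^{-2}-\alpha)\frac{\langle x,p\rangle}{\langle p,p\rangle}\,p+\alpha x .$$ A nonidentical isometry is parabolic if it fixes exactly one isotropic point of $\mathbb PV$ (a point with $\langle p,p\rangle=0$); a parabolic isometry is unipotent if it has a unipotent lift to $\mathrm{SU}(2,1)$; and a unipotent isometry is $2$-step unipotent if it fixes an isotropic point $p$ and fixes every point of the polar line $\mathbb P(p^\perp)$.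 Proposition. Let $\alpha\in\mathbb C$ with $|\alpha|=1$, $\alpha\notin\Omega$ and $\alpha^3\in\Omega\cup-\Omega$. Then every $2$-step unipotent isometry $F\in\mathrm{PU}(2,1)$ admits an $\alpha^{(3)}$-decomposition: there are nonisotropic points $p_1,p_2,p_3\in\mathbb PV$ such that $R_\alpha^{p_3}R_\alpha^{p_2}R_\alpha^{p_1}$ is a lift of $F$ to $\mathrm{SU}(2,1)$. -/

import Mathlib

open scoped LinearAlgebra.Projectivization Pointwise ComplexConjugate

noncomputable section

namespace ComplexHyperbolic

/-- The set `{1, ω, ω²}` of cube roots of unity, `ω = exp (2πi/3)`. -/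
def Omega : Set ℂ :=
  {1, Complex.exp (2 * Real.pi * Complex.I / 3), Complex.exp (2 * Real.pi * Complex.I / 3) ^ 2}

/-- A parameter: a unit complex number which is not a cube root of unity. -/
def IsParameter (α : ℂ) : Prop := ‖α‖ = 1 ∧ α ∉ Omega

variable {V : Type*} [AddCommGroup V] [Module ℂ V]

/-- The sesquilinear form `h` (linear in the first variable) is Hermitian and has signature
`++-` on the 3-dimensional space `V`. -/
structure IsHermitianSignature21 (h : V →ₗ[ℂ] V →ₛₗ[starRingEnd ℂ] ℂ) : Prop where
  conj_symm : ∀ x y, conj (h x y) = h y x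
  exists_basis : ∃ b : Module.Basis (Fin 3) ℂ V,
    ∀ i j, h (b i) (b j) = if i = j then (![1, 1, -1] : Fin 3 → ℂ) i else 0

/-- The special unitary group of the form `h`. -/
def SU (h : V →ₗ[ℂ] V →ₛₗ[starRingEnd ℂ] ℂ) : Subgroup (V ≃ₗ[ℂ] V) where
  carrier := {g | (∀ x y, h (g x) (g y) = h x y) ∧ LinearMap.det (g : V →ₗ[ℂ] V) = 1}
  one_mem' := ⟨fun _ _ => rfl, LinearMap.det_id⟩
  mul_mem' := by
    rintro a b ⟨ha, ha'⟩ ⟨hb, hb'⟩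
    refine ⟨fun x y => ?_, ?_⟩
    · rw [LinearEquiv.mul_apply, LinearEquiv.mul_apply, ha, hb]
    · have : ((a * b : V ≃ₗ[ℂ] V) : V →ₗ[ℂ] V) = (a : V →ₗ[ℂ] V) * (b : V →ₗ[ℂ] V) := rfl
      rw [this, map_mul, ha', hb', one_mul]
  inv_mem' := by
    rintro a ⟨ha, ha'⟩
    have h1 : ∀ x, a (a⁻¹ x) = x := fun x => a.apply_symm_apply x
    refine ⟨fun x y => ?_, ?_⟩
    · rw [← ha, h1, h1]
    · have h2 : (a : V →ₗ[ℂ] V) * ((a⁻¹ : V ≃ₗ[ℂ] V) : V →ₗ[ℂ] V) = 1 :=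
        LinearMap.ext h1
      have h3 := congrArg LinearMap.det h2
      rwa [map_mul, ha', one_mul, map_one] at h3

/-- The subgroup of `SU h` of the scalar maps `x ↦ δ x` with `δ ^ 3 = 1`. -/
def cubeRootScalars (h : V →ₗ[ℂ] V →ₛₗ[starRingEnd ℂ] ℂ) : Subgroup (SU h) where
  carrier := {g | ∃ δ : ℂ, δ ^ 3 = 1 ∧ ∀ x, (g : V ≃ₗ[ℂ] V) x = δ • x}
  one_mem' := ⟨1, one_pow 3, fun x => (one_smul ℂ x).symm⟩
  mul_mem' := by
    rintro a b ⟨δ, hδ, ha⟩ ⟨ε, hε, hb⟩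
    refine ⟨δ * ε, by rw [mul_pow, hδ, hε, one_mul], fun x => ?_⟩
    rw [Subgroup.coe_mul, LinearEquiv.mul_apply, hb, ha, smul_smul]
  inv_mem' := by
    rintro a ⟨δ, hδ, ha⟩
    have hδ0 : δ ≠ 0 := by
      rintro rfl
      norm_num at hδ
    refine ⟨δ⁻¹, by rw [inv_pow, hδ, inv_one], fun x => ?_⟩
    apply (a : V ≃ₗ[ℂ] V).injective
    rw [map_smul, ha x, smul_smul, inv_mul_cancel₀ hδ0, one_smul]
    exact (a : V ≃ₗ[ℂ] V).apply_symm_apply x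

instance (h : V →ₗ[ℂ] V →ₛₗ[starRingEnd ℂ] ℂ) : (cubeRootScalars h).Normal where
  conj_mem := by
    rintro n ⟨δ, hδ, hn⟩ g
    refine ⟨δ, hδ, fun x => ?_⟩
    change (g : V ≃ₗ[ℂ] V) ((n : V ≃ₗ[ℂ] V) ((g : V ≃ₗ[ℂ] V).symm x)) = δ • x
    rw [hn, map_smul, LinearEquiv.apply_symm_apply]

/-- The projective unitary group `PU(2,1) = SU(2,1)/{1, ω, ω²}`. Its elements are the
isometries; the elements of `SU h` in the class of an isometry are its lifts. -/
abbrev PU (h : V →ₗ[ℂ] V →ₛₗ[starRingEnd ℂ] ℂ) : Type _ := SU h ⧸ cubeRootScalars h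

/-- Isotropic points of the projective plane. -/
def IsIsotropic (h : V →ₗ[ℂ] V →ₛₗ[starRingEnd ℂ] ℂ) (p : ℙ ℂ V) : Prop :=
  h p.rep p.rep = 0

/-- `q` lies on the polar line `ℙ p^⊥` of `p`. -/
def IsOnPolarLine (h : V →ₗ[ℂ] V →ₛₗ[starRingEnd ℂ] ℂ) (p q : ℙ ℂ V) : Prop :=
  h q.rep p.rep = 0

/-- The isometry `F` fixes the point `p` of the projective plane. -/
def FixesPoint {h : V →ₗ[ℂ] V →ₛₗ[starRingEnd ℂ] ℂ} (F : PU h) (p : ℙ ℂ V) : Prop :=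
  ∀ g : SU h, (g : PU h) = F → (g : V ≃ₗ[ℂ] V) • p = p

/-- A nonidentical isometry is parabolic if it fixes exactly one isotropic point. -/
def IsParabolic {h : V →ₗ[ℂ] V →ₛₗ[starRingEnd ℂ] ℂ} (F : PU h) : Prop :=
  F ≠ 1 ∧ ∃! p : ℙ ℂ V, IsIsotropic h p ∧ FixesPoint F p

/-- A parabolic isometry is unipotent if it lifts to a unipotent element. -/
def IsUnipotentIsometry {h : V →ₗ[ℂ] V →ₛₗ[starRingEnd ℂ] ℂ} (F : PU h) : Prop :=
  IsParabolic F ∧ ∃ g : SU h, (g : PU h) = F ∧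
    IsNilpotent (((g : V ≃ₗ[ℂ] V) : Module.End ℂ V) - 1)

/-- A unipotent isometry is 2-step if it fixes an isotropic point and fixes pointwise the
(Euclidean) polar line of that point. -/
def IsTwoStepUnipotent {h : V →ₗ[ℂ] V →ₛₗ[starRingEnd ℂ] ℂ} (F : PU h) : Prop :=
  IsUnipotentIsometry F ∧ ∃ p : ℙ ℂ V, IsIsotropic h p ∧ FixesPoint F p ∧
    ∀ q : ℙ ℂ V, IsOnPolarLine h p q → FixesPoint F q

/-- The special elliptic isometry with center `p` and parameter `α`,
`x ↦ (α⁻² - α) (⟨x, p⟩ / ⟨p, p⟩) p + α x`, in terms of a representative `p` of the center. -/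
def specialElliptic (h : V →ₗ[ℂ] V →ₛₗ[starRingEnd ℂ] ℂ) (α : ℂ) (p : V) : Module.End ℂ V where
  toFun x := ((α ^ (-2 : ℤ) - α) * (h x p / h p p)) • p + α • x
  map_add' x y := by
    simp only [map_add, LinearMap.add_apply, add_div, mul_add, add_smul, smul_add]
    abel
  map_smul' c x := by
    simp only [map_smul, LinearMap.smul_apply, smul_eq_mul, RingHom.id_apply, smul_add, smul_smul]
    congr 2 <;> ring

/-- The special elliptic isometry depends only on the point of the projective plane. -/
theorem specialElliptic_smul (h : V →ₗ[ℂ] V →ₛₗ[starRingEnd ℂ] ℂ) (α : ℂ) (p : V) (c : ℂ)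
    (hc : c ≠ 0) : specialElliptic h α (c • p) = specialElliptic h α p := by
  ext x
  have hc' : conj c ≠ 0 := by simpa using hc
  simp only [specialElliptic, LinearMap.coe_mk, AddHom.coe_mk, map_smul, LinearMap.smul_apply,
    map_smulₛₗ, smul_eq_mul, smul_smul]
  congr 2
  by_cases h0 : h p p = 0
  · simp [h0]
  · field_simp

/-- `F` admits an `(α₁, …, αₙ)`-decomposition: some lift of `F` in `SU(2,1)` equals
`R_{αₙ}^{pₙ} ⋯ R_{α₁}^{p₁}` for nonisotropic points `p₁, …, pₙ`. -/
def HasDecomposition {h : V →ₗ[ℂ] V →ₛₗ[starRingEnd ℂ] ℂ} {n : ℕ} (α : Fin n → ℂ)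
    (F : PU h) : Prop :=
  ∃ g : SU h, (g : PU h) = F ∧ ∃ p : Fin n → ℙ ℂ V, (∀ i, ¬ IsIsotropic h (p i)) ∧
    ((g : V ≃ₗ[ℂ] V) : Module.End ℂ V) =
      (List.ofFn fun i => specialElliptic h (α i) (p i).rep).reverse.prod

end ComplexHyperbolic

end

namespace ComplexHyperbolic

/-! In a hyperbolic frame at its fixed isotropic point, a lift of `F` is a vertical translation `e₃
↦ e₃ + s i e₁` with `s ≠ 0` real (`IsTwoStepUnipotent.exists_frame`). Rescaling the frame divides
`s` by any positive real, so only its sign matters, and it suffices to treat the translation by `3(z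
- z²)`, `z` a primitive cube root of unity.

Let `T` be the unitary map `e₁ ↦ e₁`, `e₂ ↦ z e₂`, `e₃ ↦ e₃ + (z - z²) e₁`; then `T³` is that
translation. For centers `p, Tp, T²p` the product of the three special elliptics is `T³ (T⁻¹R)³`,
with `R` centered at `p`. As `T⁻¹R` is unitary of determinant `z²`, its cube is the scalar `z²` once
its trace vanishes, which fixes `⟨p, p⟩`. One value of `α³` has no such solution and uses centers on
the polar line of `e₁`. `IsHyperbolicFrame.exists_centers` checks both constructions in coordinates.
-/

/-- A basis `e₁, e₂, e₃` in which the Hermitian form is `x₁ȳ₃ + x₂ȳ₂ + x₃ȳ₁`. -/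
structure IsHyperbolicFrame {V : Type*} [AddCommGroup V] [Module ℂ V]
    (h : V →ₗ[ℂ] V →ₛₗ[starRingEnd ℂ] ℂ) (e₁ e₂ e₃ : V) : Prop where
  h11 : h e₁ e₁ = 0
  h12 : h e₁ e₂ = 0
  h13 : h e₁ e₃ = 1
  h21 : h e₂ e₁ = 0
  h22 : h e₂ e₂ = 1
  h23 : h e₂ e₃ = 0
  h31 : h e₃ e₁ = 1
  h32 : h e₃ e₂ = 0
  h33 : h e₃ e₃ = 0
  span : ∀ x : V, ∃ a b c : ℂ, x = a • e₁ + b • e₂ + c • e₃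

/-! ### Hyperbolic frames -/

section Frame

variable {V : Type*} [AddCommGroup V] [Module ℂ V] {h : V →ₗ[ℂ] V →ₛₗ[starRingEnd ℂ] ℂ}
  {e₁ e₂ e₃ : V}

theorem IsHyperbolicFrame.form_apply (he : IsHyperbolicFrame h e₁ e₂ e₃) (a b c x y w : ℂ) :
    h (a • e₁ + b • e₂ + c • e₃) (x • e₁ + y • e₂ + w • e₃) =
      a * conj w + b * conj y + c * conj x := by
  simp only [map_add, LinearMap.add_apply, map_smul, LinearMap.smul_apply, map_smulₛₗ,
    smul_eq_mul, he.h11, he.h12, he.h13, he.h21, he.h22, he.h23, he.h31, he.h32, he.h33]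
  ring

/-- In the new frame a vertical translation by `r` becomes one by `r / t²`. -/
theorem IsHyperbolicFrame.scale (he : IsHyperbolicFrame h e₁ e₂ e₃) {t : ℝ} (ht : t ≠ 0) :
    IsHyperbolicFrame h ((t : ℂ) • e₁) e₂ ((t : ℂ)⁻¹ • e₃) where
  h11 := by rw [map_smulₛₗ, map_smul, LinearMap.smul_apply, he.h11, smul_zero, smul_zero]
  h12 := by rw [map_smul, LinearMap.smul_apply, he.h12, smul_zero]
  h13 := by simp [he.h13, ht]
  h21 := by rw [map_smulₛₗ, he.h21, smul_zero]
  h22 := he.h22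
  h23 := by rw [map_smulₛₗ, he.h23, smul_zero]
  h31 := by
    rw [map_smulₛₗ, map_smul, LinearMap.smul_apply, he.h31]
    simp [ht]
  h32 := by rw [map_smul, LinearMap.smul_apply, he.h32, smul_zero]
  h33 := by rw [map_smulₛₗ, map_smul, LinearMap.smul_apply, he.h33, smul_zero, smul_zero]
  span x := by
    have ht' : (t : ℂ) ≠ 0 := by exact_mod_cast ht
    obtain ⟨a, b, c, rfl⟩ := he.span x
    refine ⟨a / t, b, c * t, ?_⟩
    simp only [smul_smul, mul_assoc, div_mul_cancel₀ _ ht', mul_inv_cancel₀ ht', mul_one]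

theorem exists_isHyperbolicFrame (hh : IsHermitianSignature21 h) {v : V} (hv : v ≠ 0)
    (hvv : h v v = 0) : ∃ e₂ e₃ : V, IsHyperbolicFrame h v e₂ e₃ := by
  obtain ⟨b, hb⟩ := hh.exists_basis
  have form (x y : Fin 3 → ℂ) : h (∑ i, x i • b i) (∑ i, y i • b i) =
      x 0 * conj (y 0) + x 1 * conj (y 1) - x 2 * conj (y 2) := by
    simp [Fin.sum_univ_three, hb]
    ring
  obtain ⟨p, rfl⟩ : ∃ p : Fin 3 → ℂ, v = ∑ i, p i • b i := ⟨b.repr v, (b.sum_repr v).symm⟩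
  rw [form] at hvv
  set n : ℂ := p 0 * conj (p 0) + p 1 * conj (p 1) + p 2 * conj (p 2) with hn
  have hn_real : n = ((Complex.normSq (p 0) + Complex.normSq (p 1) + Complex.normSq (p 2) : ℝ) : ℂ) := by
    simp [hn, Complex.mul_conj]
  have hn0 : n ≠ 0 := by
    intro h0
    rw [hn_real] at h0
    have h0' : Complex.normSq (p 0) + Complex.normSq (p 1) + Complex.normSq (p 2) = 0 := by
      exact_mod_cast h0
    have i0 := Complex.normSq_nonneg (p 0)
    have i1 := Complex.normSq_nonneg (p 1)
    have i2 := Complex.normSq_nonneg (p 2)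
    apply hv
    have j0 : p 0 = 0 := Complex.normSq_eq_zero.1 (by linarith)
    have j1 : p 1 = 0 := Complex.normSq_eq_zero.1 (by linarith)
    have j2 : p 2 = 0 := Complex.normSq_eq_zero.1 (by linarith)
    simp [Fin.sum_univ_three, j0, j1, j2]
  have hnc : conj n = n := by rw [hn_real, Complex.conj_ofReal]
  -- `w` flips the sign of the negative coordinate of `v`, normalized by the Euclidean square norm
  -- `n`. `u` is the Hermitian cross product of `v` and `w`, so `key` below is Lagrange's identity.
  let w : Fin 3 → ℂ := ![p 0 / n, p 1 / n, -p 2 / n]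
  let u : Fin 3 → ℂ := ![conj (p 1 * w 2 - p 2 * w 1), conj (p 2 * w 0 - p 0 * w 2),
    -conj (p 0 * w 1 - p 1 * w 0)]
  set e₁ := ∑ i, p i • b i
  set e₂ := ∑ i, u i • b i
  set e₃ := ∑ i, w i • b i
  have h13 : h e₁ e₃ = 1 := by
    rw [form]; simp [w, hnc]; field_simp; rw [hn]; ring
  have h33 : h e₃ e₃ = 0 := by
    rw [form]; simp [w, hnc]; field_simp; linear_combination hvv
  have h12 : h e₁ e₂ = 0 := by
    rw [form]; simp only [u, Matrix.cons_val_zero, Matrix.cons_val_one, Matrix.cons_val, map_neg, Complex.conj_conj]; ring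
  have h32 : h e₃ e₂ = 0 := by
    rw [form]; simp only [u, Matrix.cons_val_zero, Matrix.cons_val_one, Matrix.cons_val, map_neg, Complex.conj_conj]; ring
  have h11 : h e₁ e₁ = 0 := by rw [form]; exact hvv
  have h31 : h e₃ e₁ = 1 := by rw [← hh.conj_symm, h13, map_one]
  have h22 : h e₂ e₂ = 1 := by
    have key : h e₂ e₂ = h e₁ e₃ * h e₃ e₁ - h e₁ e₁ * h e₃ e₃ := by
      simp only [e₁, e₂, e₃, form]
      simp only [u, Matrix.cons_val_zero, Matrix.cons_val_one, Matrix.cons_val, map_neg, Complex.conj_conj, map_sub, map_mul]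
      ring
    rw [key, h13, h31, h11, h33]; ring
  have h21 : h e₂ e₁ = 0 := by rw [← hh.conj_symm, h12, map_zero]
  have h23 : h e₂ e₃ = 0 := by rw [← hh.conj_symm, h32, map_zero]
  have hli : LinearIndependent ℂ ![e₁, e₂, e₃] := by
    rw [Fintype.linearIndependent_iff]
    intro g hg
    simp only [Fin.sum_univ_three, Matrix.cons_val_zero, Matrix.cons_val_one, Matrix.cons_val] at hg
    have a0 := congrArg (fun x => h x e₃) hg
    have a1 := congrArg (fun x => h x e₂) hg
    have a2 := congrArg (fun x => h x e₁) hg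
    simp [h11, h12, h13, h21, h22, h23, h31, h32, h33] at a0 a1 a2
    intro i
    fin_cases i <;> assumption
  have hcard : Fintype.card (Fin 3) = Module.finrank ℂ V := by
    rw [Module.finrank_eq_card_basis b]
  let B := basisOfLinearIndependentOfCardEqFinrank hli hcard
  refine ⟨e₂, e₃, h11, h12, h13, h21, h22, h23, h31, h32, h33, fun x => ?_⟩
  refine ⟨B.repr x 0, B.repr x 1, B.repr x 2, ?_⟩
  conv_lhs => rw [← B.sum_repr x]
  simp [Fin.sum_univ_three, B]

/-- With `β = α⁻³`, factoring out `α` leaves the reflection multiplying the center by `β` and fixing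
its orthogonal complement. -/
theorem IsHyperbolicFrame.specialElliptic_apply (he : IsHyperbolicFrame h e₁ e₂ e₃) {α β : ℂ}
    (hα : α ≠ 0) (hβ : α ^ 3 * β = 1) (x y w a b c : ℂ) :
    specialElliptic h α (x • e₁ + y • e₂ + w • e₃) (a • e₁ + b • e₂ + c • e₃) =
      α • ((a + (β - 1) * ((a * conj w + b * conj y + c * conj x) /
          (x * conj w + y * conj y + w * conj x)) * x) • e₁ +
        (b + (β - 1) * ((a * conj w + b * conj y + c * conj x) /
          (x * conj w + y * conj y + w * conj x)) * y) • e₂ +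
        (c + (β - 1) * ((a * conj w + b * conj y + c * conj x) /
          (x * conj w + y * conj y + w * conj x)) * w) • e₃) := by
  have hc : α ^ (-2 : ℤ) - α = α * (β - 1) := by
    rw [zpow_neg]
    field_simp
    norm_cast
    linear_combination (-1 : ℂ) * hβ
  simp only [specialElliptic, LinearMap.coe_mk, AddHom.coe_mk, he.form_apply, hc]
  module

/-! ### Explicit triples of centers -/

set_option linter.unusedSimpArgs false in
/-- A vertical translation, up to a cube root of unity, as a product of three special elliptic
isometries whose centers project to an equilateral triangle. -/
theorem IsHyperbolicFrame.exists_centers (he : IsHyperbolicFrame h e₁ e₂ e₃) {α z : ℂ}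
    (hz : z ^ 2 + z + 1 = 0) (hzc : conj z = z ^ 2)
    (hα : α ^ 3 = -1 ∨ α ^ 3 = -z ∨ α ^ 3 = -z ^ 2 ∨ α ^ 3 = z ∨ α ^ 3 = z ^ 2) :
    ∃ p₁ p₂ p₃ : V, h p₁ p₁ ≠ 0 ∧ h p₂ p₂ ≠ 0 ∧ h p₃ p₃ ≠ 0 ∧
      ∀ a b c : ℂ, specialElliptic h α p₃ (specialElliptic h α p₂ (specialElliptic h α p₁
        (a • e₁ + b • e₂ + c • e₃))) =
        z ^ 2 • ((a + 3 * (z - z ^ 2) * c) • e₁ + b • e₂ + c • e₃) := by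
  have hz3 : z ^ 3 = 1 := by linear_combination (z - 1) * hz
  have hzc2 : conj (z ^ 2) = z := by rw [map_pow, hzc]; linear_combination z * hz3
  have hz2 : z ^ 2 = -z - 1 := by linear_combination hz
  have hα0 : α ≠ 0 := by
    rintro rfl
    have : z ≠ 0 := by rintro rfl; norm_num at hz
    simp [this, eq_comm (a := (0 : ℂ))] at hα
  -- `N` is the common norm of the centers. Vanishing of the trace of `T⁻¹R` reads `N (β - z) = 3 (1
  -- - β) z²`, whose solutions are listed in `hrel`; `β = z` is excluded.
  have general (β A N : ℂ) (hβ : α ^ 3 * β = 1) (hA : conj A = A) (hN : N = 2 * A + 1)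
      (hN0 : N ≠ 0)
      (hrel : (α ^ 3 = -1 ∧ β = -1 ∧ N = 6) ∨ (α ^ 3 = -z ^ 2 ∧ β = -z ∧ N = 3 / 2) ∨
        (α ^ 3 = -z ∧ β = -z ^ 2 ∧ N = -3) ∨ (α ^ 3 = z ∧ β = z ^ 2 ∧ N = 3)) :
      ∃ p₁ p₂ p₃ : V, h p₁ p₁ ≠ 0 ∧ h p₂ p₂ ≠ 0 ∧ h p₃ p₃ ≠ 0 ∧
      ∀ a b c : ℂ, specialElliptic h α p₃ (specialElliptic h α p₂ (specialElliptic h α p₁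
        (a • e₁ + b • e₂ + c • e₃))) =
        z ^ 2 • ((a + 3 * (z - z ^ 2) * c) • e₁ + b • e₂ + c • e₃) := by
    have c1 : conj (A + (2 * z + 1)) = A - (2 * z + 1) := by
      simp only [map_add, map_mul, hA, hzc, map_ofNat, map_one]; linear_combination 2 * hz
    have c2 : conj (A + 2 * (2 * z + 1)) = A - 2 * (2 * z + 1) := by
      simp only [map_add, map_mul, hA, hzc, map_ofNat, map_one]; linear_combination 4 * hz
    have n0 : A * conj (1 : ℂ) + 1 * conj (1 : ℂ) + 1 * conj A = N := by
      rw [hA, hN, map_one]; ring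
    have n1 : (A + (2 * z + 1)) * conj (1 : ℂ) + z * conj z + 1 * conj (A + (2 * z + 1)) = N := by
      rw [c1, hN, hzc, map_one]; linear_combination hz3
    have n2 : (A + 2 * (2 * z + 1)) * conj (1 : ℂ) + z ^ 2 * conj (z ^ 2) +
        1 * conj (A + 2 * (2 * z + 1)) = N := by
      rw [c2, hN, hzc2, map_one]; linear_combination hz3
    -- These are `p, Tp, T²p`, since `z - z² = 2z + 1`.
    refine ⟨A • e₁ + (1 : ℂ) • e₂ + (1 : ℂ) • e₃, (A + (2 * z + 1)) • e₁ + z • e₂ + (1 : ℂ) • e₃,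
      (A + 2 * (2 * z + 1)) • e₁ + z ^ 2 • e₂ + (1 : ℂ) • e₃, ?_, ?_, ?_, fun a b c => ?_⟩
    · rwa [he.form_apply, n0]
    · rwa [he.form_apply, n1]
    · rwa [he.form_apply, n2]
    · rw [he.specialElliptic_apply hα0 hβ, map_smul, he.specialElliptic_apply hα0 hβ, map_smul,
        map_smul, he.specialElliptic_apply hα0 hβ, n0, n1, n2, smul_smul, smul_smul]
      simp only [hA, c1, c2, hzc, hzc2, map_one, mul_one, smul_add, smul_smul]
      have hα3 (t : ℂ) : α * α * α * t = α ^ 3 * t := by ring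
      obtain rfl : A = (N - 1) / 2 := by rw [hN]; ring
      have hred (n : ℕ) : z ^ (n + 3) = z ^ n := by rw [pow_add, hz3, mul_one]
      have hz4 : z ^ 4 = z := (hred 1).trans (pow_one z)
      have hz5 : z ^ 5 = -z - 1 := (hred 2).trans hz2
      have hz6 : z ^ 6 = 1 := (hred 3).trans hz3
      have hz7 : z ^ 7 = z := (hred 4).trans hz4
      have hz8 : z ^ 8 = -z - 1 := (hred 5).trans hz5
      have hz9 : z ^ 9 = 1 := (hred 6).trans hz6
      have hz10 : z ^ 10 = z := (hred 7).trans hz7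
      have hz11 : z ^ 11 = -z - 1 := (hred 8).trans hz8
      have hz12 : z ^ 12 = 1 := (hred 9).trans hz9
      have hz13 : z ^ 13 = z := (hred 10).trans hz10
      have hz14 : z ^ 14 = -z - 1 := (hred 11).trans hz11
      have hz15 : z ^ 15 = 1 := (hred 12).trans hz12
      clear hN c1 c2 n0 n1 n2 hA hN0
      rcases hrel with ⟨h1, rfl, rfl⟩ | ⟨h1, rfl, rfl⟩ | ⟨h1, rfl, rfl⟩ | ⟨h1, rfl, rfl⟩ <;>
      · simp only [hα3, h1]
        clear hα3 h1 hβ hα hα0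
        congr 1
        · congr 1
          · congr 1
            ring_nf
            simp only [hz2, hz3, hz4, hz5, hz6, hz7, hz8, hz9, hz10, hz11, hz12, hz13,
              hz14, hz15]
            ring
          · congr 1
            ring_nf
            simp only [hz2, hz3, hz4, hz5, hz6, hz7, hz8, hz9, hz10, hz11, hz12, hz13,
              hz14, hz15]
            ring
        · congr 1
          ring_nf
          simp only [hz2, hz3, hz4, hz5, hz6, hz7, hz8, hz9, hz10, hz11, hz12, hz13,
              hz14, hz15]
          ring
  rcases hα with h1 | h1 | h1 | h1 | h1
  · exact general (-1) (5 / 2) 6 (by rw [h1]; ring)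
      (by simp only [map_div₀, map_neg, map_ofNat, map_one]) (by norm_num) (by norm_num)
      (Or.inl ⟨h1, rfl, rfl⟩)
  · exact general (-z ^ 2) (-2) (-3) (by rw [h1]; linear_combination hz3)
      (by simp only [map_div₀, map_neg, map_ofNat, map_one]) (by norm_num)
      (by norm_num) (Or.inr (Or.inr (Or.inl ⟨h1, rfl, rfl⟩)))
  · exact general (-z) (1 / 4) (3 / 2) (by rw [h1]; linear_combination hz3)
      (by simp only [map_div₀, map_neg, map_ofNat, map_one])
      (by norm_num) (by norm_num) (Or.inr (Or.inl ⟨h1, rfl, rfl⟩))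
  · exact general (z ^ 2) 1 3 (by rw [h1]; linear_combination hz3) (by simp) (by norm_num)
      (by norm_num) (Or.inr (Or.inr (Or.inr ⟨h1, rfl, rfl⟩)))
  -- Here `β = z`: the centers lie in `e₁^⊥`, so every factor scales `e₁` by `α`.
  · have hβ : α ^ 3 * z = 1 := by rw [h1]; linear_combination hz3
    have n0 : (1 : ℂ) * conj (0 : ℂ) + 1 * conj (1 : ℂ) + 0 * conj (1 : ℂ) = 1 := by simp
    have n1 : z * conj (0 : ℂ) + 1 * conj (1 : ℂ) + 0 * conj z = 1 := by simp
    have n2 : z ^ 2 * conj (0 : ℂ) + 1 * conj (1 : ℂ) + 0 * conj (z ^ 2) = 1 := by simp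
    refine ⟨(1 : ℂ) • e₁ + (1 : ℂ) • e₂ + (0 : ℂ) • e₃, z • e₁ + (1 : ℂ) • e₂ + (0 : ℂ) • e₃,
      z ^ 2 • e₁ + (1 : ℂ) • e₂ + (0 : ℂ) • e₃, ?_, ?_, ?_, fun a b c => ?_⟩
    · rw [he.form_apply, n0]; exact one_ne_zero
    · rw [he.form_apply, n1]; exact one_ne_zero
    · rw [he.form_apply, n2]; exact one_ne_zero
    · rw [he.specialElliptic_apply hα0 hβ, map_smul, he.specialElliptic_apply hα0 hβ, map_smul,
        map_smul, he.specialElliptic_apply hα0 hβ, n0, n1, n2, smul_smul, smul_smul]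
      simp only [hzc, hzc2, map_one, map_zero, mul_one, mul_zero, add_zero, zero_add, div_one,
        smul_add, smul_smul]
      have hα3 : α * α * α = z ^ 2 := by rw [← h1]; ring
      rw [hα3]
      congr 1
      congr 1
      · congr 1
        grind
      · congr 1
        grind

end Frame

/-! ### Lifts of isometries -/

section Lifts

variable {V : Type*} [AddCommGroup V] [Module ℂ V] {h : V →ₗ[ℂ] V →ₛₗ[starRingEnd ℂ] ℂ}

theorem isIsotropic_mk_iff {x : V} (hx : x ≠ 0) :
    IsIsotropic h (Projectivization.mk ℂ x hx) ↔ h x x = 0 := by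
  obtain ⟨a, ha⟩ := Projectivization.exists_smul_eq_mk_rep ℂ x hx
  rw [IsIsotropic, ← ha, Units.smul_def, map_smulₛₗ, map_smul, LinearMap.smul_apply]
  simp

theorem isOnPolarLine_mk {p : ℙ ℂ V} {x : V} (hx : x ≠ 0) (hxp : h x p.rep = 0) :
    IsOnPolarLine h p (Projectivization.mk ℂ x hx) := by
  obtain ⟨a, ha⟩ := Projectivization.exists_smul_eq_mk_rep ℂ x hx
  rw [IsOnPolarLine, ← ha, Units.smul_def, map_smul, LinearMap.smul_apply, hxp, smul_zero]

theorem specialElliptic_mk_rep (α : ℂ) {x : V} (hx : x ≠ 0) :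
    specialElliptic h α (Projectivization.mk ℂ x hx).rep = specialElliptic h α x := by
  obtain ⟨a, ha⟩ := Projectivization.exists_smul_eq_mk_rep ℂ x hx
  rw [← ha, Units.smul_def, specialElliptic_smul h α x a a.ne_zero]

theorem exists_apply_eq_smul_of_fixesPoint {F : PU h} {x : V} {hx : x ≠ 0}
    (hF : FixesPoint F (Projectivization.mk ℂ x hx)) {g : SU h} (hg : (g : PU h) = F) :
    ∃ c : ℂ, (g : V ≃ₗ[ℂ] V) x = c • x := by
  have := hF g hg
  rw [Projectivization.smul_mk, Projectivization.mk_eq_mk_iff'] at this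
  obtain ⟨c, hc⟩ := this
  exact ⟨c, hc.symm⟩

theorem eq_one_of_isNilpotent_sub_one {f : Module.End ℂ V} (hf : IsNilpotent (f - 1)) {x : V}
    (hx : x ≠ 0) {c : ℂ} (hc : f x = c • x) : c = 1 := by
  obtain ⟨n, hn⟩ := hf
  have key (m : ℕ) : ((f - 1) ^ m) x = (c - 1) ^ m • x := by
    induction m with
    | zero => simp
    | succ m ih =>
      rw [pow_succ', Module.End.mul_apply, ih, map_smul, LinearMap.sub_apply, hc,
        Module.End.one_apply, pow_succ, mul_smul, sub_smul, one_smul]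
  have h0 := key n
  rw [hn, LinearMap.zero_apply, eq_comm, smul_eq_zero, or_iff_left hx] at h0
  exact sub_eq_zero.1 (IsReduced.eq_zero _ ⟨n, h0⟩)

/-- A lift of a 2-step unipotent isometry is, in a suitable frame, a vertical translation. -/
theorem IsTwoStepUnipotent.exists_frame (hh : IsHermitianSignature21 h) {F : PU h}
    (hF : IsTwoStepUnipotent F) : ∃ (g : SU h) (e₁ e₂ e₃ : V) (s : ℝ), (g : PU h) = F ∧
      IsHyperbolicFrame h e₁ e₂ e₃ ∧ s ≠ 0 ∧ (g : V ≃ₗ[ℂ] V) e₁ = e₁ ∧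
      (g : V ≃ₗ[ℂ] V) e₂ = e₂ ∧ (g : V ≃ₗ[ℂ] V) e₃ = e₃ + (s * Complex.I) • e₁ := by
  obtain ⟨⟨⟨hF1, -⟩, g, hgF, hnil⟩, p, hp, -, hfix⟩ := hF
  obtain ⟨e₂, e₃, he⟩ := exists_isHyperbolicFrame hh p.rep_nonzero hp
  set e₁ := p.rep
  -- Fixing the polar line pointwise makes each such `x` an eigenvector; unipotence forces
  -- eigenvalue `1`.
  have polar {x : V} (hx : x ≠ 0) (hxp : h x e₁ = 0) : (g : V ≃ₗ[ℂ] V) x = x := by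
    obtain ⟨c, hc⟩ := exists_apply_eq_smul_of_fixesPoint (hfix _ (isOnPolarLine_mk hx hxp)) hgF
    have := eq_one_of_isNilpotent_sub_one hnil hx hc
    rw [hc, this, one_smul]
  have g1 : (g : V ≃ₗ[ℂ] V) e₁ = e₁ := polar p.rep_nonzero he.h11
  have hne : e₂ ≠ 0 := by
    intro h0
    have := he.h22
    rw [h0, map_zero] at this
    exact zero_ne_one this
  have g2 := polar hne he.h21
  obtain ⟨a, b, c, habc⟩ := he.span ((g : V ≃ₗ[ℂ] V) e₃)
  have i1 := g.2.1 e₃ e₁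
  have i2 := g.2.1 e₃ e₂
  have i3 := g.2.1 e₃ e₃
  rw [g1, habc] at i1
  rw [g2, habc] at i2
  rw [habc, he.form_apply] at i3
  simp only [map_add, LinearMap.add_apply, map_smul, LinearMap.smul_apply, smul_eq_mul, he.h11,
    he.h12, he.h21, he.h22, he.h31, he.h32, he.h33, mul_zero, mul_one, zero_add, add_zero]
    at i1 i2 i3
  rw [i1, i2, map_one, map_zero] at i3
  have hre : a.re = 0 := by
    have := congrArg Complex.re i3
    simp at this
    linarith
  have ha : a = a.im * Complex.I := by
    apply Complex.ext <;> simp [hre]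
  have g3 : (g : V ≃ₗ[ℂ] V) e₃ = e₃ + (a.im * Complex.I) • e₁ := by
    rw [← ha, habc, i1, i2]
    module
  refine ⟨g, e₁, e₂, e₃, a.im, hgF, he, fun h0 => hF1 ?_, g1, g2, g3⟩
  have : g = 1 := by
    ext x
    obtain ⟨a', b', c', rfl⟩ := he.span x
    simp [g1, g2, g3, h0]
  rw [← hgF, this]
  rfl

/-- The product of special elliptics is `z²` times the unipotent lift, so the lift must be changed
within its class. -/
theorem exists_smul_mem_SU (hh : IsHermitianSignature21 h) (g : SU h) {δ : ℂ} (hδ : δ ^ 3 = 1)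
    (hδc : δ * conj δ = 1) : ∃ k : SU h, (k : PU h) = g ∧
      ∀ x, (k : V ≃ₗ[ℂ] V) x = δ • (g : V ≃ₗ[ℂ] V) x := by
  have hδ0 : δ ≠ 0 := left_ne_zero_of_mul_eq_one hδc
  obtain ⟨b, -⟩ := hh.exists_basis
  let d : SU h := ⟨LinearEquiv.smulOfNeZero ℂ V δ hδ0, fun x y => by
    simp only [LinearEquiv.smulOfNeZero_apply, map_smulₛₗ, LinearMap.smul_apply, smul_eq_mul]
    linear_combination h x y * hδc, by
    have : ((LinearEquiv.smulOfNeZero ℂ V δ hδ0 : V ≃ₗ[ℂ] V) : V →ₗ[ℂ] V) = δ • LinearMap.id :=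
      rfl
    rw [this, LinearMap.det_smul, Module.finrank_eq_card_basis b, Fintype.card_fin, hδ,
      LinearMap.det_id, one_mul]⟩
  have hd : d ∈ cubeRootScalars h := ⟨δ, hδ, fun x => rfl⟩
  refine ⟨g * d, QuotientGroup.mk_mul_of_mem g hd, fun x => ?_⟩
  change (g : V ≃ₗ[ℂ] V) (δ • x) = _
  rw [map_smul]

end Lifts

/-! ### Cube roots of unity -/

theorem exp_two_pi_I_div_three :
    Complex.exp (2 * Real.pi * Complex.I / 3) = -1 / 2 + (√3 / 2 : ℝ) * Complex.I := by
  have : (2 * Real.pi * Complex.I / 3 : ℂ) = ((Real.pi - Real.pi / 3 : ℝ) : ℂ) * Complex.I := by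
    push_cast; ring
  rw [this, Complex.exp_mul_I, ← Complex.ofReal_cos, ← Complex.ofReal_sin, Real.cos_pi_sub,
    Real.sin_pi_sub, Real.cos_pi_div_three, Real.sin_pi_div_three]
  push_cast
  ring

/-- A nonzero purely imaginary number is a positive multiple of `z - z²` for one of the primitive
cube roots of unity `z`. -/
theorem exists_primitive_cube_root {s : ℝ} (hs : s ≠ 0) : ∃ (z : ℂ) (t : ℝ), t ≠ 0 ∧
    z ^ 2 + z + 1 = 0 ∧ conj z = z ^ 2 ∧ Omega = {1, z, z ^ 2} ∧
    s * Complex.I = t ^ 2 * (3 * (z - z ^ 2)) := by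
  set w : ℂ := Complex.exp (2 * Real.pi * Complex.I / 3) with hw
  have h3 : ((√3 : ℝ) : ℂ) ^ 2 = 3 := by
    rw [← Complex.ofReal_pow, Real.sq_sqrt (by norm_num)]; norm_num
  have hw' : w = -1 / 2 + (√3 / 2 : ℝ) * Complex.I := exp_two_pi_I_div_three
  have hz : w ^ 2 + w + 1 = 0 := by
    rw [hw']; push_cast
    linear_combination (3 : ℂ) / 4 * Complex.I_sq + Complex.I ^ 2 / 4 * h3
  have hw2 : w ^ 2 = -1 / 2 - (√3 / 2 : ℝ) * Complex.I := by
    linear_combination hz - hw'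
  have hw3 : w ^ 3 = 1 := by linear_combination (w - 1) * hz
  have hc : conj w = w ^ 2 := by
    rw [hw2, hw', map_add, map_mul, Complex.conj_ofReal, Complex.conj_I, map_div₀, map_neg,
      map_one, map_ofNat]
    ring
  have hd : w - w ^ 2 = √3 * Complex.I := by
    rw [hw2, hw']; push_cast; ring
  have hpos : 0 < 3 * √3 := by positivity
  -- Since `w - w² = √3 i`, matching absolute values gives `3√3 t² = |s|`; the sign of `s` then
  -- selects `w` or `w²`.
  have ht : √(|s| / (3 * √3)) ≠ 0 := by positivity
  have ht2 : ((√(|s| / (3 * √3)) : ℝ) : ℂ) ^ 2 * (3 * √3) = |s| := by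
    have : √(|s| / (3 * √3)) ^ 2 * (3 * √3) = |s| := by
      rw [Real.sq_sqrt (by positivity), div_mul_cancel₀ _ hpos.ne']
    exact_mod_cast this
  rcases hs.lt_or_gt with hs | hs
  · refine ⟨w ^ 2, √(|s| / (3 * √3)), ht, ?_, ?_, ?_, ?_⟩
    · linear_combination hz + w * hw3
    · rw [map_pow, hc]
    · have : (w ^ 2) ^ 2 = w := by linear_combination w * hw3
      rw [this, Omega, ← hw, Set.pair_comm w]
    · have hs' : ((|s| : ℝ) : ℂ) = -s := by rw [abs_of_neg hs, Complex.ofReal_neg]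
      rw [hs'] at ht2
      linear_combination Complex.I * ht2 + 3 * ((√(|s| / (3 * √3)) : ℝ) : ℂ) ^ 2 * hd +
        3 * ((√(|s| / (3 * √3)) : ℝ) : ℂ) ^ 2 * w * hw3
  · refine ⟨w, √(|s| / (3 * √3)), ht, hz, hc, rfl, ?_⟩
    rw [abs_of_pos hs] at ht2 ⊢
    rw [hd]
    linear_combination (-Complex.I) * ht2

end ComplexHyperbolic

open ComplexHyperbolic

theorem mainTheorem8 {V : Type*} [AddCommGroup V] [Module ℂ V]
    (h : V →ₗ[ℂ] V →ₛₗ[starRingEnd ℂ] ℂ) (hh : ComplexHyperbolic.IsHermitianSignature21 h)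
    (α : ℂ) (hα : ComplexHyperbolic.IsParameter α)
    (hα3 : α ^ 3 ∈ ComplexHyperbolic.Omega ∪ -ComplexHyperbolic.Omega)
    (F : ComplexHyperbolic.PU h) (hF : ComplexHyperbolic.IsTwoStepUnipotent F) :
    ComplexHyperbolic.HasDecomposition (fun _ : Fin 3 => α) F := by
  obtain ⟨g, e₁, e₂, e₃, s, hgF, he, hs, g1, g2, g3⟩ := hF.exists_frame hh
  obtain ⟨z, t, ht, hz, hzc, hΩ, hst⟩ := exists_primitive_cube_root hs
  have hz3 : z ^ 3 = 1 := by linear_combination (z - 1) * hz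
  have ht' : (t : ℂ) ≠ 0 := by exact_mod_cast ht
  have hα1 : α ^ 3 ≠ 1 := by
    intro h1
    refine hα.2 ?_
    -- This product is `α³ - 1`.
    have : (α - 1) * ((α - z) * (α - z ^ 2)) = 0 := by
      linear_combination h1 + (-α ^ 2 + α * z) * hz - hz3
    rw [hΩ]
    simpa [sub_eq_zero] using this
  have hcases : α ^ 3 = -1 ∨ α ^ 3 = -z ∨ α ^ 3 = -z ^ 2 ∨ α ^ 3 = z ∨ α ^ 3 = z ^ 2 := by
    rw [hΩ] at hα3
    simp only [Set.mem_union, Set.mem_neg, Set.mem_insert_iff, Set.mem_singleton_iff,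
      neg_eq_iff_eq_neg] at hα3
    tauto
  have he' := he.scale ht
  obtain ⟨p₁, p₂, p₃, h1, h2, h3, hprod⟩ := he'.exists_centers hz hzc hcases
  obtain ⟨k, hk, hkx⟩ := exists_smul_mem_SU hh g (δ := z ^ 2)
    (by linear_combination (z ^ 3 + 1) * hz3)
    (by rw [map_pow, hzc]; linear_combination (z ^ 3 + 1) * hz3)
  have ne {x : V} (hx : h x x ≠ 0) : x ≠ 0 := by
    rintro rfl
    exact hx (by simp)
  refine ⟨k, hk.trans hgF, ![Projectivization.mk ℂ p₁ (ne h1), Projectivization.mk ℂ p₂ (ne h2),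
    Projectivization.mk ℂ p₃ (ne h3)], fun i => ?_, LinearMap.ext fun x => ?_⟩
  · fin_cases i
    · exact (isIsotropic_mk_iff _).not.2 h1
    · exact (isIsotropic_mk_iff _).not.2 h2
    · exact (isIsotropic_mk_iff _).not.2 h3
  · obtain ⟨a, b, c, rfl⟩ := he'.span x
    have hlist : (List.ofFn fun i : Fin 3 => specialElliptic h α
        ((![Projectivization.mk ℂ p₁ (ne h1), Projectivization.mk ℂ p₂ (ne h2),
          Projectivization.mk ℂ p₃ (ne h3)] : Fin 3 → ℙ ℂ V) i).rep).reverse.prod =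
        specialElliptic h α p₃ * (specialElliptic h α p₂ * specialElliptic h α p₁) := by
      simp [List.ofFn_succ, specialElliptic_mk_rep]
    rw [hlist, Module.End.mul_apply, Module.End.mul_apply, hprod]
    refine (hkx _).trans ?_
    simp only [map_add, map_smul, g1, g2, g3, hst, smul_add, smul_smul]
    have : c * ((t : ℂ)⁻¹ * (t ^ 2 * (3 * (z - z ^ 2)))) = 3 * (z - z ^ 2) * c * t := by
      field_simp
    simp only [mul_assoc] at this ⊢
    rw [this]
    module
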